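/- Let $N=\mathbb R^7$ with coordinates $(x,\ell_1,\ell_2,\ell_3,y_1,y_2,y_3)$ and consider the vector fields $$N_1=\partial_x-\Big(-\tfrac{\sqrt3}{2}x+\ell_1-1\Big)\partial_{y_1}-(\ell_2-1)\,\partial_{y_2}-\Big(\tfrac{\sqrt3}{2}x+\ell_3-1\Big)\partial_{y_3},\qquad N_2=\partial_{\ell_1},\quad N_3=\partial_{\ell_2},\quad N_4=\partial_{\ell_3},$$ and the distributions $E=\langle N_1\rangle$ and $V=\langle N_2,N_3,N_4\rangle$ in $TN$. A generalized path geometry on a manifold of dimension $2n+1$ is a pair $(E,V)$ of smooth subbundles of the tangent bundle, of ranks $1$ and $n$, such that (1) $E\cap V=0$; (2) the Lie bracket of two sections of $V$ is a section of $E\oplus V$; (3) for $\xi\in\Gamma(E)$, $\nu\in\Gamma(V)$ and a point $q$, $[\xi,\nu](q)\in E_q\oplus V_q$ implies $\xi(q)=0$ or $\nu(q)=0$. An infinitesimal symmetry of $(N,E,V)$ is a smooth vector field $X$ on $N$ whose Lie derivative preserves both subbundles: $[X,\Gamma(E)]\subseteq\Gamma(E)$ and $[X,\Gamma(V)]\subseteq\Gamma(V)$;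 the infinitesimal symmetries form a Lie algebra $\mathfrak s$ under the Lie bracket of vector fields. Let $P_{1,2}\subset PSL(5,\mathbb R)$ be the stabilizer of the flag $\langle e_1\rangle\subset\langle e_1,e_2\rangle$ of a line in a plane in $\mathbb R^5$. The generalized flag manifold $PSL(5,\mathbb R)/P_{1,2}$, whose points are the pairs (line $\subset$ plane) in $\mathbb R^5$, carries the flat generalized path geometry $(E_0,V_0)$, in which $E_0$ (of rank $1$) is tangent to the fibres of the projection (line, plane) $\mapsto$ plane and $V_0$ (of rank $3$) is tangent to the fibres of (line, plane) $\mapsto$ line. Then: 1. $(E,V)$ is a generalized path geometry on the $7$-dimensional manifold $N$. 2. $\dim\mathfrak s=24$, and $\mathfrak s$ is isomorphic to $\mathfrak{sl}(5,\mathbb R)$ as a real Lie algebra. 3. $(N,E,V)$ is flat, with model $PSL(5,\mathbb R)/P_{1,2}$, and its infinitesimal symmetries come from left multiplication: there are an injective smooth map $f:N\to PSL(5,\mathbb R)/P_{1,2}$ with everywhere bijective differential which maps $E$ onto $E_0$ and $V$ onto $V_0$ (so $f$ is an isomorphism of $(N,E,V)$ onto an open subset of the flat model), and an isomorphism of Lie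 algebras $\Phi:\mathfrak{sl}(5,\mathbb R)\to\mathfrak s$ such that, for every $A\in\mathfrak{sl}(5,\mathbb R)$, the differential of $f$ maps $\Phi(A)$ to the infinitesimal generator of the flow $z\mapsto\exp(-tA)\,z$ on $PSL(5,\mathbb R)/P_{1,2}$. -/

import Mathlib

open scoped ContDiff MatrixGroups Topology

noncomputable section

namespace PathGeometry

section VectorFields

variable (M : Type*) [NormedAddCommGroup M] [NormedSpace ℝ M]

/-- The real vector space of smooth vector fields on the normed space `M`. -/
def SmoothVectorField : Submodule ℝ (M → M) where
  carrier := {X | ContDiff ℝ ∞ X}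
  add_mem' {X Y} (hX : ContDiff ℝ ∞ X) (hY : ContDiff ℝ ∞ Y) := ContDiff.add hX hY
  zero_mem' := (contDiff_const : ContDiff ℝ ∞ fun _ : M => (0 : M))
  smul_mem' c X (hX : ContDiff ℝ ∞ X) := ContDiff.const_smul c hX

variable {M}

theorem SmoothVectorField.contDiff (X : SmoothVectorField M) : ContDiff ℝ ∞ (X : M → M) := X.2

theorem SmoothVectorField.differentiableAt (X : SmoothVectorField M) (q : M) :
    DifferentiableAt ℝ (X : M → M) q :=
  ((SmoothVectorField.contDiff X).differentiable (by simp)).differentiableAt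

/-- The bracket is the usual Lie bracket of vector fields, `[X, Y](q) = DY(q) X(q) - DX(q) Y(q)`. -/
instance : Bracket (SmoothVectorField M) (SmoothVectorField M) where
  bracket X Y := ⟨VectorField.lieBracket ℝ (X : M → M) (Y : M → M),
    ContDiff.lieBracket_vectorField (m := ∞) (n := ∞) X.2 Y.2
      (WithTop.coe_le_coe.2 le_top)⟩

theorem SmoothVectorField.coe_lie (X Y : SmoothVectorField M) :
    ((⁅X, Y⁆ : SmoothVectorField M) : M → M)
      = VectorField.lieBracket ℝ (X : M → M) (Y : M → M) := rfl

instance : LieRing (SmoothVectorField M) where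
  add_lie X Y Z := by
    ext1; funext q
    exact VectorField.lieBracket_add_left
      (SmoothVectorField.differentiableAt X q) (SmoothVectorField.differentiableAt Y q)
  lie_add X Y Z := by
    ext1; funext q
    exact VectorField.lieBracket_add_right
      (SmoothVectorField.differentiableAt Y q) (SmoothVectorField.differentiableAt Z q)
  lie_self X := by
    ext1
    exact VectorField.lieBracket_self
  leibniz_lie X Y Z := by
    ext1; funext q
    exact VectorField.leibniz_identity_lieBracket (n := ∞)
      (by rw [minSmoothness_of_isRCLikeNormedField]; exact WithTop.coe_le_coe.2 le_top)
      (SmoothVectorField.contDiff X).contDiffAt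
      (SmoothVectorField.contDiff Y).contDiffAt
      (SmoothVectorField.contDiff Z).contDiffAt

instance : LieAlgebra ℝ (SmoothVectorField M) where
  lie_smul c X Y := by
    ext1; funext q
    exact VectorField.lieBracket_const_smul_right (SmoothVectorField.differentiableAt Y q)

/-- A field of tangent subspaces `D` is a smooth subbundle of rank `r`: locally it has a smooth
frame consisting of `r` vector fields. -/
def IsSmoothSubbundle (r : ℕ) (D : M → Submodule ℝ M) : Prop :=
  ∀ q, ∃ U : Set M, IsOpen U ∧ q ∈ U ∧ ∃ X : Fin r → M → M,
    (∀ i, ContDiffOn ℝ ∞ (X i) U) ∧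
    ∀ p ∈ U, LinearIndependent ℝ (fun i => X i p) ∧
      Submodule.span ℝ (Set.range fun i => X i p) = D p

/-- The smooth vector field `X` is a section of the field of subspaces `D`. -/
def IsSection (D : M → Submodule ℝ M) (X : SmoothVectorField M) : Prop :=
  ∀ q, (X : M → M) q ∈ D q

/-- `(E, V)` is a generalized path geometry on the `(2n+1)`-dimensional space `M`. -/
structure IsGeneralizedPathGeometry (n : ℕ) (E V : M → Submodule ℝ M) : Prop where
  finiteDimensional : FiniteDimensional ℝ M
  finrank_eq : Module.finrank ℝ M = 2 * n + 1
  line_bundle : IsSmoothSubbundle 1 E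
  bundle : IsSmoothSubbundle n V
  inf_eq_bot : ∀ q, E q ⊓ V q = ⊥
  lie_mem : ∀ X Y : SmoothVectorField M, IsSection V X → IsSection V Y →
    IsSection (fun q => E q ⊔ V q) ⁅X, Y⁆
  nondegenerate : ∀ X Y : SmoothVectorField M, IsSection E X → IsSection V Y → ∀ q,
    (⁅X, Y⁆ : SmoothVectorField M).1 q ∈ E q ⊔ V q → X.1 q = 0 ∨ Y.1 q = 0

/-- The Lie algebra of infinitesimal symmetries of `(E, V)`: the smooth vector fields `X` whose
Lie derivative preserves both subbundles, `ℒ_X Γ(E) ⊆ Γ(E)` and `ℒ_X Γ(V) ⊆ Γ(V)`. -/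
def symmetryAlgebra (E V : M → Submodule ℝ M) : LieSubalgebra ℝ (SmoothVectorField M) where
  carrier := {X | (∀ Y, IsSection E Y → IsSection E ⁅X, Y⁆) ∧
    (∀ Y, IsSection V Y → IsSection V ⁅X, Y⁆)}
  add_mem' {X X'} hX hX' := by
    refine ⟨fun Y hY q => ?_, fun Y hY q => ?_⟩
    · rw [add_lie]; exact (E q).add_mem (hX.1 Y hY q) (hX'.1 Y hY q)
    · rw [add_lie]; exact (V q).add_mem (hX.2 Y hY q) (hX'.2 Y hY q)
  zero_mem' := by
    refine ⟨fun Y _ q => ?_, fun Y _ q => ?_⟩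
    · rw [zero_lie]; exact (E q).zero_mem
    · rw [zero_lie]; exact (V q).zero_mem
  smul_mem' c X hX := by
    refine ⟨fun Y hY q => ?_, fun Y hY q => ?_⟩
    · rw [smul_lie]; exact (E q).smul_mem c (hX.1 Y hY q)
    · rw [smul_lie]; exact (V q).smul_mem c (hX.2 Y hY q)
  lie_mem' {X X'} hX hX' := by
    refine ⟨fun Y hY q => ?_, fun Y hY q => ?_⟩
    · rw [lie_lie]
      exact (E q).sub_mem (hX.1 _ (hX'.1 Y hY) q) (hX'.1 _ (hX.1 Y hY) q)
    · rw [lie_lie]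
      exact (V q).sub_mem (hX.2 _ (hX'.2 Y hY) q) (hX'.2 _ (hX.2 Y hY) q)

end VectorFields

section Nilpotent

/-- The manifold `N = ℝ⁷`; the coordinates `(x, ℓ₁, ℓ₂, ℓ₃, y₁, y₂, y₃)` have
the indices `0, …, 6`. -/
abbrev N : Type := Fin 7 → ℝ

/-- `N₁ = ∂ₓ - (-(√3/2) x + ℓ₁ - 1) ∂_{y₁} - (ℓ₂ - 1) ∂_{y₂} - ((√3/2) x + ℓ₃ - 1) ∂_{y₃}`. -/
def N₁ (q : N) : N :=
  ![1, 0, 0, 0, -(-√3 / 2 * q 0 + q 1 - 1), -(q 2 - 1), -(√3 / 2 * q 0 + q 3 - 1)]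

/-- `N₂ = ∂_{ℓ₁}`. -/
def N₂ (_ : N) : N := ![0, 1, 0, 0, 0, 0, 0]

/-- `N₃ = ∂_{ℓ₂}`. -/
def N₃ (_ : N) : N := ![0, 0, 1, 0, 0, 0, 0]

/-- `N₄ = ∂_{ℓ₃}`. -/
def N₄ (_ : N) : N := ![0, 0, 0, 1, 0, 0, 0]

/-- `E = ⟨N₁⟩`. -/
def E (q : N) : Submodule ℝ N := Submodule.span ℝ {N₁ q}

/-- `V = ⟨N₂, N₃, N₄⟩`. -/
def V (q : N) : Submodule ℝ N := Submodule.span ℝ {N₂ q, N₃ q, N₄ q}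

end Nilpotent

section FlatModel

/-- The line of the standard flag in `ℝ⁵`. -/
def stdLine : Submodule ℝ (Fin 5 → ℝ) := Submodule.span ℝ {Pi.single 0 1}

/-- The plane of the standard flag in `ℝ⁵`. -/
def stdPlane : Submodule ℝ (Fin 5 → ℝ) := Submodule.span ℝ {Pi.single 0 1, Pi.single 1 1}

open scoped Pointwise in
/-- The parabolic subgroup `P_{1,2}` of `PSL(5, ℝ)`: the stabilizer of the flag
`stdLine ⊂ stdPlane`. -/
def P₁₂ : Subgroup PSL(5, ℝ) :=
  (MulAction.stabilizer SL(5, ℝ) stdLine ⊓ MulAction.stabilizer SL(5, ℝ) stdPlane).map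
    (QuotientGroup.mk' (Subgroup.center SL(5, ℝ)))

/-- The generalized flag manifold `PSL(5, ℝ) / P_{1,2}`. -/
abbrev FlatModel : Type := PSL(5, ℝ) ⧸ P₁₂

/-- The canonical projection `SL(5, ℝ) → PSL(5, ℝ) → PSL(5, ℝ) / P_{1,2}`. -/
def toModel (g : SL(5, ℝ)) : FlatModel := QuotientGroup.mk (QuotientGroup.mk g : PSL(5, ℝ))

/-- `A W ⊆ W`. -/
def Stabilizes (A : Matrix (Fin 5) (Fin 5) ℝ) (W : Submodule ℝ (Fin 5 → ℝ)) : Prop :=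
  ∀ v ∈ W, A.mulVec v ∈ W

/-- For trace-free `A`: membership in the parabolic subalgebra `𝔭 = 𝔭_{1,2}` of `𝔰𝔩(5, ℝ)`. -/
def StabilizesFlag (A : Matrix (Fin 5) (Fin 5) ℝ) : Prop :=
  Stabilizes A stdLine ∧ Stabilizes A stdPlane

variable {M : Type*} [NormedAddCommGroup M] [NormedSpace ℝ M]

/-- `σ` is a smooth lift of `f : M → PSL(5, ℝ) / P_{1,2}` to `SL(5, ℝ)` over the open set `U`.
Since `SL(5, ℝ) → PSL(5, ℝ) / P_{1,2}` is a surjective submersion, `f` is smooth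
if and only if such lifts exist locally. -/
structure IsSmoothLift (f : M → FlatModel) (U : Set M) (σ : M → SL(5, ℝ)) : Prop where
  isOpen : IsOpen U
  contDiffOn : ∀ i j, ContDiffOn ℝ ∞ (fun p => (σ p : Matrix (Fin 5) (Fin 5) ℝ) i j) U
  lift : ∀ p ∈ U, f p = toModel (σ p)

/-- The pulled back Maurer-Cartan form `σ⁻¹ dσ`, evaluated at `q` on the tangent vector `X`.

The tangent space of `G / P` at `g P` is `𝔤 / 𝔭` via `A + 𝔭 ↦ d/dt (g exp (t A) P)` at `t = 0`
(this depends on `g` only through the adjoint action of `P`), and if `σ` lifts `f`, then the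
differential of `f` at `q` is `X ↦ σ⁻¹ dσ (X) + 𝔭` in terms of `g = σ q`. -/
def maurerCartan (σ : M → SL(5, ℝ)) (q X : M) : Matrix (Fin 5) (Fin 5) ℝ :=
  ((σ q)⁻¹ : SL(5, ℝ)).1 *
    Matrix.of fun i j => fderiv ℝ (fun p => (σ p : Matrix (Fin 5) (Fin 5) ℝ) i j) q X

/-- `f : M → PSL(5, ℝ) / P_{1,2}` is a local isomorphism from `(M, E, V)` to the flat generalized
path geometry. The latter consists of the `PSL(5, ℝ)`-invariant subbundles tangent to the fibres
of the two projections of a flag to its plane and to its line: in `𝔤 / 𝔭` they are `𝔭₂ / 𝔭` and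
`𝔭₁ / 𝔭`, where `𝔭₂` and `𝔭₁` are the stabilizers of the standard plane and line in `𝔰𝔩(5, ℝ)`.

The conditions: `f` is smooth, its differential is bijective at all points, and it maps `E` and
`V` onto these two subbundles. -/
def IsLocalIsoToModel (E V : M → Submodule ℝ M) (f : M → FlatModel) : Prop :=
  ∀ q, ∃ (U : Set M) (σ : M → SL(5, ℝ)), q ∈ U ∧ IsSmoothLift f U σ ∧ ∀ p ∈ U,
    (∀ A : LieAlgebra.SpecialLinear.sl (Fin 5) ℝ,
      ∃! X : M, StabilizesFlag (A.1 - maurerCartan σ p X)) ∧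
    (∀ X : M, X ∈ E p ↔ Stabilizes (maurerCartan σ p X) stdPlane) ∧
    (∀ X : M, X ∈ V p ↔ Stabilizes (maurerCartan σ p X) stdLine)

/-- The differential of `f : M → PSL(5, ℝ) / P_{1,2}` maps the vector field `X` to the
infinitesimal generator of the action `z ↦ exp (t A) z` by left multiplication; at the point
`σ P_{1,2}` this generator is the class of `σ⁻¹ A σ`. -/
def IsRelatedToGenerator (f : M → FlatModel) (X : M → M) (A : Matrix (Fin 5) (Fin 5) ℝ) : Prop :=
  ∀ q, ∃ (U : Set M) (σ : M → SL(5, ℝ)), q ∈ U ∧ IsSmoothLift f U σ ∧ ∀ p ∈ U,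
    StabilizesFlag (maurerCartan σ p (X p) - ((σ p)⁻¹ : SL(5, ℝ)).1 * A * (σ p).1)

end FlatModel

end PathGeometry

end

open Module (finrank finrank_self finrank_matrix)

/-! In the coordinates `Y₁ = y₁ - (√3/4) x² - x`, `Y₂ = y₂ - x`, `Y₃ = y₃ + (√3/4) x² - x`, the
field `N₁` becomes `∂ₓ - Σ ℓᵢ ∂_{Yᵢ}`. So `E` is tangent to the lifts of the straight lines in the
`(x, Y)`-space `ℝ⁴`, with `-ℓ` as slope, and `V` is the vertical bundle over this `ℝ⁴`. Regarding
`ℝ⁴` as an affine chart of `ℝP⁴` and sending a point with a direction to the flag spanned by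
`pointVec` and `dirVec` gives the open embedding into the flat model (`isLocalIsoToModel`,
`injective_toModel_flagLift`).

Every matrix acts by an infinitesimal projective transformation, which is a symmetry
(`projField_mem`). Conversely, preserving `V` makes a symmetry descend to a field `F` on `ℝ⁴`
(`pointDeriv_chart`), and preserving `E` shows that `F` determines the symmetry
(`eq_of_pointDeriv_eq`) and that the second derivative of `F` along a line is tangent to this line
(`exists_hasDerivAt`). Such an `F` has the form `F 0 + L z + φ(z) z` (`exists_quadratic`), so the
symmetry comes from a matrix (`exists_projField_eq`). Exactly the scalar matrices act trivially,
which leaves `sl(5, ℝ)`, of dimension 24. -/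

namespace PathGeometry

/-! ### Flag coordinates and their differentials -/

/-- The homogeneous coordinates `(1, x, Y₁, Y₂, Y₃)` of the point of the flag at `q`, where
`Y₁, Y₂, Y₃` are coordinates straightening the integral curves of `E`. -/
noncomputable def pointVec (q : N) : Fin 5 → ℝ :=
  ![1, q 0, q 4 + (-√3 / 4 * q 0 ^ 2 - q 0), q 5 - q 0, q 6 + (√3 / 4 * q 0 ^ 2 - q 0)]

/-- The direction `(0, 1, -ℓ₁, -ℓ₂, -ℓ₃)` of the line of the flag at `q`. -/
noncomputable def dirVec (q : N) : Fin 5 → ℝ := ![0, 1, -q 1, -q 2, -q 3]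

/-- The differential of `pointVec`. -/
noncomputable def pointDeriv (q : N) : N →L[ℝ] (Fin 5 → ℝ) :=
  LinearMap.toContinuousLinearMap
    { toFun := fun v => ![0, v 0, v 4 + (-√3 / 2 * q 0 - 1) * v 0, v 5 - v 0,
        v 6 + (√3 / 2 * q 0 - 1) * v 0]
      map_add' := fun v w => by ext i; fin_cases i <;> simp <;> ring
      map_smul' := fun c v => by ext i; fin_cases i <;> simp <;> ring }

/-- The differential of `dirVec`. -/
noncomputable def dirDeriv : N →L[ℝ] (Fin 5 → ℝ) :=
  LinearMap.toContinuousLinearMap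
    { toFun := fun v => ![0, 0, -v 1, -v 2, -v 3]
      map_add' := fun v w => by ext i; fin_cases i <;> simp <;> ring
      map_smul' := fun c v => by ext i; fin_cases i <;> simp }

theorem pointDeriv_apply (q v : N) : pointDeriv q v =
    ![0, v 0, v 4 + (-√3 / 2 * q 0 - 1) * v 0, v 5 - v 0, v 6 + (√3 / 2 * q 0 - 1) * v 0] := rfl

theorem dirDeriv_apply (v : N) : dirDeriv v = ![0, 0, -v 1, -v 2, -v 3] := rfl

theorem hasFDerivAt_pointVec (q : N) : HasFDerivAt pointVec (pointDeriv q) q := by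
  have h (i : Fin 7) : HasFDerivAt (fun p : N => p i)
      (ContinuousLinearMap.proj (R := ℝ) (φ := fun _ : Fin 7 => ℝ) i) q :=
    hasFDerivAt_apply i q
  rw [hasFDerivAt_pi']
  intro i
  fin_cases i
  · exact (hasFDerivAt_const (1 : ℝ) q).congr_fderiv (by ext; simp [pointDeriv_apply])
  · exact (h 0).congr_fderiv (by ext; simp [pointDeriv_apply])
  · refine ((h 4).add ((((h 0).pow 2).const_mul (-√3 / 4)).sub (h 0))).congr_fderiv ?_
    ext v; simp [pointDeriv_apply]; ring
  · exact ((h 5).sub (h 0)).congr_fderiv (by ext; simp [pointDeriv_apply])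
  · refine ((h 6).add ((((h 0).pow 2).const_mul (√3 / 4)).sub (h 0))).congr_fderiv ?_
    ext v; simp [pointDeriv_apply]; ring

theorem hasFDerivAt_dirVec (q : N) : HasFDerivAt dirVec dirDeriv q := by
  have h (i : Fin 7) : HasFDerivAt (fun p : N => p i)
      (ContinuousLinearMap.proj (R := ℝ) (φ := fun _ : Fin 7 => ℝ) i) q :=
    hasFDerivAt_apply i q
  rw [hasFDerivAt_pi']
  intro i
  fin_cases i
  · exact (hasFDerivAt_const (0 : ℝ) q).congr_fderiv (by ext; simp [dirDeriv_apply])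
  · exact (hasFDerivAt_const (1 : ℝ) q).congr_fderiv (by ext; simp [dirDeriv_apply])
  · exact (h 1).neg.congr_fderiv (by ext; simp [dirDeriv_apply])
  · exact (h 2).neg.congr_fderiv (by ext; simp [dirDeriv_apply])
  · exact (h 3).neg.congr_fderiv (by ext; simp [dirDeriv_apply])

theorem contDiff_pointVec : ContDiff ℝ ∞ pointVec := by
  rw [contDiff_pi]
  intro i
  fin_cases i <;> simp [pointVec] <;> fun_prop

theorem contDiff_dirVec : ContDiff ℝ ∞ dirVec := by
  rw [contDiff_pi]
  intro i
  fin_cases i <;> simp [dirVec] <;> fun_prop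

/-- Along a lifted line the direction is constant and the point moves in that direction. With
`mem_V_iff` this replaces the explicit frames in all later arguments. -/
theorem mem_E_iff (q v : N) : v ∈ E q ↔ dirDeriv v = 0 ∧ pointDeriv q v = v 0 • dirVec q := by
  rw [E, Submodule.mem_span_singleton, pointDeriv_apply, dirDeriv_apply]
  constructor
  · rintro ⟨c, rfl⟩
    constructor
    · ext i; fin_cases i <;> simp [N₁]
    · ext i; fin_cases i <;> simp [N₁, dirVec] <;> ring
  · rintro ⟨h, h'⟩
    refine ⟨v 0, ?_⟩
    have h2 := congrFun h 2
    have h3 := congrFun h 3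
    have h4 := congrFun h 4
    have k2 := congrFun h' 2
    have k3 := congrFun h' 3
    have k4 := congrFun h' 4
    simp [dirVec] at h2 h3 h4 k2 k3 k4
    ext i; fin_cases i <;> simp [N₁] <;> linarith

theorem mem_V_iff (q v : N) : v ∈ V q ↔ pointDeriv q v = 0 := by
  rw [V, Submodule.mem_span_triple, pointDeriv_apply]
  constructor
  · rintro ⟨a, b, c, rfl⟩
    ext i; fin_cases i <;> simp [N₂, N₃, N₄]
  · intro h
    refine ⟨v 1, v 2, v 3, ?_⟩
    have k1 : v 0 = 0 := congrFun h 1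
    have k2 := congrFun h 2
    have k3 := congrFun h 3
    have k4 := congrFun h 4
    simp [k1] at k2 k3 k4
    ext i; fin_cases i <;> simp [N₂, N₃, N₄, k1, k2, k3, k4]

theorem pointDeriv_of_mem_sup {q v : N} (h : v ∈ E q ⊔ V q) :
    pointDeriv q v = v 0 • dirVec q := by
  obtain ⟨a, ha, b, hb, rfl⟩ := Submodule.mem_sup.1 h
  rw [mem_E_iff] at ha
  rw [mem_V_iff] at hb
  have : b 0 = 0 := congrFun hb 1
  simp [ha.2, hb, this]

theorem N₁_mem_E (q : N) : N₁ q ∈ E q := Submodule.mem_span_singleton_self _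

theorem pointDeriv_N₁ (q : N) : pointDeriv q (N₁ q) = dirVec q := by
  rw [((mem_E_iff _ _).1 (N₁_mem_E q)).2]; simp [N₁]

theorem dirDeriv_N₁ (q : N) : dirDeriv (N₁ q) = 0 := ((mem_E_iff _ _).1 (N₁_mem_E q)).1

/-! ### Tangent vectors modulo the parabolic directions -/

/-- The tangent vector at `q` along which `pointVec` and `dirVec` move by `w` and `u` modulo the
tangent directions of the parabolic subgroup. -/
noncomputable def solve (q : N) (w u : Fin 5 → ℝ) : N :=
  ![w 1 - w 0 * q 0,
    -(u 2 - u 0 * pointVec q 2 + (u 1 - u 0 * q 0) * q 1),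
    -(u 3 - u 0 * pointVec q 3 + (u 1 - u 0 * q 0) * q 2),
    -(u 4 - u 0 * pointVec q 4 + (u 1 - u 0 * q 0) * q 3),
    w 2 - w 0 * pointVec q 2 - (-√3 / 2 * q 0 - 1) * (w 1 - w 0 * q 0),
    w 3 - w 0 * pointVec q 3 + (w 1 - w 0 * q 0),
    w 4 - w 0 * pointVec q 4 - (√3 / 2 * q 0 - 1) * (w 1 - w 0 * q 0)]

theorem pointDeriv_solve (q : N) (w u : Fin 5 → ℝ) :
    pointDeriv q (solve q w u) = w - w 0 • pointVec q := by
  rw [pointDeriv_apply]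
  ext i; fin_cases i <;> simp [solve, pointVec]

theorem dirDeriv_solve (q : N) (w u : Fin 5 → ℝ) :
    dirDeriv (solve q w u) = u - u 0 • pointVec q - (u 1 - u 0 * q 0) • dirVec q := by
  rw [dirDeriv_apply]
  ext i; fin_cases i <;> simp [solve, pointVec, dirVec, Matrix.vecHead, Matrix.vecTail]

theorem deriv_injective {q v v' : N} (h : pointDeriv q v = pointDeriv q v')
    (h' : dirDeriv v = dirDeriv v') : v = v' := by
  rw [pointDeriv_apply, pointDeriv_apply] at h
  rw [dirDeriv_apply, dirDeriv_apply] at h'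
  have h2 := congrFun h' 2
  have h3 := congrFun h' 3
  have h4 := congrFun h' 4
  have k1 : v 0 = v' 0 := congrFun h 1
  have k2 := congrFun h 2
  have k3 := congrFun h 3
  have k4 := congrFun h 4
  simp [k1] at h2 h3 h4 k2 k3 k4
  ext i; fin_cases i <;> simp [*]

/-- The differentials have coordinate 0 equal to zero, and that of `dirVec` also has coordinate 1
equal to zero, while `pointVec` and `dirVec` begin with `1, x` and `0, 1`. Coordinates 0 and 1
therefore fix all coefficients in the two spans. -/
theorem eq_solve_iff {q v : N} {w u : Fin 5 → ℝ} : v = solve q w u ↔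
    (w - pointDeriv q v ∈ Submodule.span ℝ {pointVec q} ∧
      u - dirDeriv v ∈ Submodule.span ℝ {pointVec q, dirVec q}) := by
  constructor
  · rintro rfl
    rw [pointDeriv_solve, dirDeriv_solve, Submodule.mem_span_singleton, Submodule.mem_span_pair]
    exact ⟨⟨w 0, by abel⟩, ⟨u 0, u 1 - u 0 * q 0, by abel⟩⟩
  · rintro ⟨h, h'⟩
    obtain ⟨c, hc⟩ := Submodule.mem_span_singleton.1 h
    obtain ⟨a, b, hab⟩ := Submodule.mem_span_pair.1 h'
    have c0 := congrFun hc 0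
    have a0 := congrFun hab 0
    have b0 := congrFun hab 1
    simp [pointVec, dirVec, pointDeriv_apply, dirDeriv_apply] at c0 a0 b0
    apply deriv_injective (q := q)
    · rw [pointDeriv_solve, ← c0, hc]; abel
    · rw [dirDeriv_solve, ← a0, show u 1 - a * q 0 = b by linarith, sub_sub, hab]; abel

theorem pointVec_dirVec_injective {q q' : N} (h : pointVec q = pointVec q')
    (h' : dirVec q = dirVec q') : q = q' := by
  have h2 := congrFun h' 2
  have h3 := congrFun h' 3
  have h4 := congrFun h' 4
  have k1 : q 0 = q' 0 := congrFun h 1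
  have k2 := congrFun h 2
  have k3 := congrFun h 3
  have k4 := congrFun h 4
  simp [pointVec, dirVec, k1] at h2 h3 h4 k2 k3 k4
  ext i; fin_cases i <;> simp [*]

/-! ### The developing map into the flag manifold -/

/-- The matrix with the columns `pointVec q`, `dirVec q`, `e₂`, `e₃`, `e₄`. -/
noncomputable def flagMatrix (q : N) : Matrix (Fin 5) (Fin 5) ℝ :=
  Matrix.of fun i => ![pointVec q i, dirVec q i, (Pi.single 2 1 : Fin 5 → ℝ) i,
    (Pi.single 3 1 : Fin 5 → ℝ) i, (Pi.single 4 1 : Fin 5 → ℝ) i]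

theorem det_flagMatrix (q : N) : (flagMatrix q).det = 1 := by
  rw [Matrix.det_of_isLowerTriangular]
  · simp [Fin.prod_univ_succ, flagMatrix, pointVec, dirVec]
  · intro i j h
    have h : i < j := h
    fin_cases i <;> fin_cases j <;> simp_all [flagMatrix, pointVec, dirVec]

/-- The lift of the developing map to `SL(5, ℝ)`. -/
noncomputable def flagLift (q : N) : SL(5, ℝ) := ⟨flagMatrix q, det_flagMatrix q⟩

theorem flagLift_mulVec (q : N) (v : Fin 5 → ℝ) : (flagLift q).1.mulVec v =
    v 0 • pointVec q + v 1 • dirVec q + ![0, 0, v 2, v 3, v 4] := by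
  ext i
  fin_cases i <;>
    simp [flagLift, flagMatrix, Matrix.mulVec, dotProduct, Fin.sum_univ_succ] <;> ring

theorem inv_mulVec_eq_iff (g : SL(5, ℝ)) (v w : Fin 5 → ℝ) :
    ((g⁻¹ : SL(5, ℝ)).1).mulVec v = w ↔ v = g.1.mulVec w :=
  inv_smul_eq_iff (g := g) (a := v) (b := w)

theorem inv_mulVec_mem_stdLine (q : N) (v : Fin 5 → ℝ) :
    ((flagLift q)⁻¹ : SL(5, ℝ)).1.mulVec v ∈ stdLine ↔ v ∈ Submodule.span ℝ {pointVec q} := by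
  rw [stdLine, Submodule.mem_span_singleton, Submodule.mem_span_singleton]
  refine exists_congr fun c => ?_
  rw [eq_comm, inv_mulVec_eq_iff, eq_comm, flagLift_mulVec]
  convert Iff.rfl using 2
  ext i; fin_cases i <;> simp

theorem inv_mulVec_mem_stdPlane (q : N) (v : Fin 5 → ℝ) :
    ((flagLift q)⁻¹ : SL(5, ℝ)).1.mulVec v ∈ stdPlane ↔
      v ∈ Submodule.span ℝ {pointVec q, dirVec q} := by
  rw [stdPlane, Submodule.mem_span_pair, Submodule.mem_span_pair]
  refine exists_congr fun a => exists_congr fun b => ?_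
  rw [eq_comm, inv_mulVec_eq_iff, eq_comm, flagLift_mulVec]
  convert Iff.rfl using 2
  ext i; fin_cases i <;> simp

theorem stabilizes_stdLine_iff (A : Matrix (Fin 5) (Fin 5) ℝ) :
    Stabilizes A stdLine ↔ A.mulVec (Pi.single 0 1) ∈ stdLine := by
  refine ⟨fun h => h _ (Submodule.mem_span_singleton_self _), fun h v hv => ?_⟩
  obtain ⟨c, rfl⟩ := Submodule.mem_span_singleton.1 hv
  rw [Matrix.mulVec_smul]
  exact Submodule.smul_mem _ _ h

theorem stabilizes_stdPlane_iff (A : Matrix (Fin 5) (Fin 5) ℝ) :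
    Stabilizes A stdPlane ↔
      A.mulVec (Pi.single 0 1) ∈ stdPlane ∧ A.mulVec (Pi.single 1 1) ∈ stdPlane := by
  refine ⟨fun h => ⟨h _ (Submodule.subset_span (by simp)), h _ (Submodule.subset_span (by simp))⟩,
    fun h v hv => ?_⟩
  obtain ⟨a, b, rfl⟩ := Submodule.mem_span_pair.1 hv
  rw [Matrix.mulVec_add, Matrix.mulVec_smul, Matrix.mulVec_smul]
  exact Submodule.add_mem _ (Submodule.smul_mem _ _ h.1) (Submodule.smul_mem _ _ h.2)

theorem stabilizesFlag_iff (A : Matrix (Fin 5) (Fin 5) ℝ) :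
    StabilizesFlag A ↔ A.mulVec (Pi.single 0 1) ∈ stdLine ∧ A.mulVec (Pi.single 1 1) ∈ stdPlane := by
  rw [StabilizesFlag, stabilizes_stdLine_iff, stabilizes_stdPlane_iff]
  have : stdLine ≤ stdPlane := Submodule.span_mono (by simp)
  exact ⟨fun h => ⟨h.1, h.2.2⟩, fun h => ⟨h.1, this h.1, h.2⟩⟩

theorem fderiv_flagLift (q X : N) :
    (Matrix.of fun i j => fderiv ℝ (fun p => (flagLift p : Matrix (Fin 5) (Fin 5) ℝ) i j) q X) =
      Matrix.of fun i => ![pointDeriv q X i, dirDeriv X i, 0, 0, 0] := by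
  ext i j
  have h1 := (hasFDerivAt_pi'.1 (hasFDerivAt_pointVec q) i).fderiv
  have h2 := (hasFDerivAt_pi'.1 (hasFDerivAt_dirVec q) i).fderiv
  fin_cases j <;> simp [flagLift, flagMatrix, h1, h2]

theorem maurerCartan_mulVec_zero (q X : N) : (maurerCartan flagLift q X).mulVec (Pi.single 0 1) =
    ((flagLift q)⁻¹ : SL(5, ℝ)).1.mulVec (pointDeriv q X) := by
  rw [maurerCartan, fderiv_flagLift, ← Matrix.mulVec_mulVec]
  congr 1
  ext i; simp

theorem maurerCartan_mulVec_one (q X : N) : (maurerCartan flagLift q X).mulVec (Pi.single 1 1) =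
    ((flagLift q)⁻¹ : SL(5, ℝ)).1.mulVec (dirDeriv X) := by
  rw [maurerCartan, fderiv_flagLift, ← Matrix.mulVec_mulVec]
  congr 1
  ext i; simp

theorem flagLift_mulVec_single_zero (q : N) :
    (flagLift q).1.mulVec (Pi.single 0 1) = pointVec q := by
  rw [flagLift_mulVec]; ext i; fin_cases i <;> simp

theorem flagLift_mulVec_single_one (q : N) :
    (flagLift q).1.mulVec (Pi.single 1 1) = dirVec q := by
  rw [flagLift_mulVec]; ext i; fin_cases i <;> simp

/-- Only the first two columns matter modulo the parabolic subalgebra. Taking `B = σ A` gives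
bijectivity of the differential, and `B = -A σ` identifies the generators of the action. -/
theorem stabilizesFlag_sub_maurerCartan_iff (q X : N) (B : Matrix (Fin 5) (Fin 5) ℝ) :
    StabilizesFlag (((flagLift q)⁻¹ : SL(5, ℝ)).1 * B - maurerCartan flagLift q X) ↔
      X = solve q (B.mulVec (Pi.single 0 1)) (B.mulVec (Pi.single 1 1)) := by
  rw [stabilizesFlag_iff, Matrix.sub_mulVec, Matrix.sub_mulVec, maurerCartan_mulVec_zero,
    maurerCartan_mulVec_one, ← Matrix.mulVec_mulVec, ← Matrix.mulVec_mulVec,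
    ← Matrix.mulVec_sub, ← Matrix.mulVec_sub, inv_mulVec_mem_stdLine, inv_mulVec_mem_stdPlane,
    eq_solve_iff]

theorem isSmoothLift_flagLift :
    IsSmoothLift (fun q => toModel (flagLift q)) Set.univ flagLift where
  isOpen := isOpen_univ
  contDiffOn i j := by
    apply ContDiff.contDiffOn
    have h1 := contDiff_pi.1 contDiff_pointVec i
    have h2 := contDiff_pi.1 contDiff_dirVec i
    fin_cases j
    · exact h1
    · exact h2
    all_goals exact contDiff_const
  lift _ _ := rfl

theorem isLocalIsoToModel : IsLocalIsoToModel E V fun q => toModel (flagLift q) := by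
  intro q
  refine ⟨Set.univ, flagLift, Set.mem_univ q, isSmoothLift_flagLift, fun p _ => ⟨?_, ?_, ?_⟩⟩
  · intro A
    have h (X : N) : StabilizesFlag (A.1 - maurerCartan flagLift p X) ↔
        X = solve p (((flagLift p).1 * A.1).mulVec (Pi.single 0 1))
          (((flagLift p).1 * A.1).mulVec (Pi.single 1 1)) := by
      rw [← stabilizesFlag_sub_maurerCartan_iff p X ((flagLift p).1 * A.1), ← Matrix.mul_assoc,
        ← Matrix.SpecialLinearGroup.coe_mul, inv_mul_cancel, Matrix.SpecialLinearGroup.coe_one,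
        Matrix.one_mul]
    exact ⟨_, (h _).2 rfl, fun X hX => (h X).1 hX⟩
  · intro X
    rw [stabilizes_stdPlane_iff, maurerCartan_mulVec_zero, maurerCartan_mulVec_one,
      inv_mulVec_mem_stdPlane, inv_mulVec_mem_stdPlane, mem_E_iff, Submodule.mem_span_pair,
      Submodule.mem_span_pair]
    constructor
    · rintro ⟨h, h'⟩
      exact ⟨⟨0, X 0, by rw [h']; simp⟩, ⟨0, 0, by rw [h]; simp⟩⟩
    · rintro ⟨⟨a, b, h⟩, ⟨c, d, h'⟩⟩
      -- Coordinate 0 kills the coefficients `a`, `c` of `pointVec`; coordinate 1 then gives `b = X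
      -- 0` and `d = 0`.
      have a0 := congrFun h 0
      have c0 := congrFun h' 0
      have b0 := congrFun h 1
      have d0 := congrFun h' 1
      simp [pointVec, dirVec, pointDeriv_apply, dirDeriv_apply] at a0 b0 c0 d0
      subst a0 c0
      simp at b0 d0
      subst b0 d0
      exact ⟨by rw [← h']; simp, by rw [← h]; simp⟩
  · intro X
    rw [stabilizes_stdLine_iff, maurerCartan_mulVec_zero, inv_mulVec_mem_stdLine, mem_V_iff,
      Submodule.mem_span_singleton]
    constructor
    · intro h
      exact ⟨0, by rw [h]; simp⟩
    · rintro ⟨a, h⟩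
      have a0 := congrFun h 0
      simp [pointVec, pointDeriv_apply] at a0
      rw [← h, a0, zero_smul]

open scoped Pointwise in
-- A representative in `SL(5, ℝ)` differs from an element of the stabilizer by a central, hence
-- scalar, matrix, and scalars preserve every subspace.
theorem mulVec_mem_of_mem_P₁₂ {g : SL(5, ℝ)} (hg : (QuotientGroup.mk g : PSL(5, ℝ)) ∈ P₁₂) :
    g.1.mulVec (Pi.single 0 1) ∈ stdLine ∧ g.1.mulVec (Pi.single 1 1) ∈ stdPlane := by
  obtain ⟨h, hh, hg⟩ := hg
  have hc : h⁻¹ * g ∈ Subgroup.center SL(5, ℝ) := QuotientGroup.eq.1 hg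
  obtain ⟨r, -, hr⟩ := Matrix.SpecialLinearGroup.mem_center_iff.1 hc
  have key (v : Fin 5 → ℝ) : g.1.mulVec v = r • h.1.mulVec v := by
    have : g = h * (h⁻¹ * g) := by group
    rw [this, Matrix.SpecialLinearGroup.coe_mul, ← hr, ← Matrix.mulVec_mulVec]
    simp [Matrix.mulVec_smul]
  have hl : ∀ v ∈ stdLine, h.1.mulVec v ∈ stdLine := fun v hv => by
    have := Submodule.smul_mem_pointwise_smul v h stdLine hv
    rwa [MulAction.mem_stabilizer_iff.1 hh.1] at this
  have hp : ∀ v ∈ stdPlane, h.1.mulVec v ∈ stdPlane := fun v hv => by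
    have := Submodule.smul_mem_pointwise_smul v h stdPlane hv
    rwa [MulAction.mem_stabilizer_iff.1 hh.2] at this
  rw [key, key]
  exact ⟨Submodule.smul_mem _ _ (hl _ (Submodule.subset_span (by simp))),
    Submodule.smul_mem _ _ (hp _ (Submodule.subset_span (by simp)))⟩

theorem injective_toModel_flagLift : Function.Injective fun q => toModel (flagLift q) := by
  intro q q' h
  have h' : (QuotientGroup.mk ((flagLift q)⁻¹ * flagLift q') : PSL(5, ℝ)) ∈ P₁₂ :=
    QuotientGroup.eq.1 h
  have := mulVec_mem_of_mem_P₁₂ h'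
  rw [Matrix.SpecialLinearGroup.coe_mul, ← Matrix.mulVec_mulVec, ← Matrix.mulVec_mulVec,
    flagLift_mulVec_single_zero, flagLift_mulVec_single_one, inv_mulVec_mem_stdLine,
    inv_mulVec_mem_stdPlane] at this
  obtain ⟨h1, h2⟩ := this
  obtain ⟨c, hc⟩ := Submodule.mem_span_singleton.1 h1
  obtain ⟨a, b, hab⟩ := Submodule.mem_span_pair.1 h2
  have c0 := congrFun hc 0
  have a0 := congrFun hab 0
  have b0 := congrFun hab 1
  simp [pointVec, dirVec] at c0 a0 b0
  subst c0 a0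
  simp at b0
  subst b0
  exact pointVec_dirVec_injective (by simpa using hc) (by simpa using hab)

/-! ### Brackets and the axioms of a path geometry -/

theorem pointDeriv_eq_fderiv (q : N) : pointDeriv q = fderiv ℝ pointVec q :=
  (hasFDerivAt_pointVec q).fderiv.symm

theorem dirDeriv_eq_fderiv (q : N) : dirDeriv = fderiv ℝ dirVec q :=
  (hasFDerivAt_dirVec q).fderiv.symm

/-- This is `[X, Y]g = X(Yg) - Y(Xg)` for the vector-valued function `g = pointVec`. -/
theorem pointDeriv_lie (X Y : SmoothVectorField N) (q : N) :
    pointDeriv q ((⁅X, Y⁆ : SmoothVectorField N).1 q) =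
      fderiv ℝ (fun p => pointDeriv p (Y.1 p)) q (X.1 q) -
        fderiv ℝ (fun p => pointDeriv p (X.1 p)) q (Y.1 q) := by
  simp only [pointDeriv_eq_fderiv]
  exact VectorField.fderiv_apply_lieBracket (n := ∞) contDiff_pointVec.contDiffAt
    (by rw [minSmoothness_of_isRCLikeNormedField]; exact WithTop.coe_le_coe.2 le_top)
    (SmoothVectorField.differentiableAt Y q) (SmoothVectorField.differentiableAt X q)

theorem dirDeriv_lie (X Y : SmoothVectorField N) (q : N) :
    dirDeriv ((⁅X, Y⁆ : SmoothVectorField N).1 q) =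
      fderiv ℝ (fun p => dirDeriv (Y.1 p)) q (X.1 q) -
        fderiv ℝ (fun p => dirDeriv (X.1 p)) q (Y.1 q) := by
  have := VectorField.fderiv_apply_lieBracket (n := ∞) (x := q) contDiff_dirVec.contDiffAt
    (by rw [minSmoothness_of_isRCLikeNormedField]; exact WithTop.coe_le_coe.2 le_top)
    (SmoothVectorField.differentiableAt Y q) (SmoothVectorField.differentiableAt X q)
  simp only [← dirDeriv_eq_fderiv] at this
  exact this

theorem IsSection.dirDeriv_eq_zero {Y : SmoothVectorField N} (hY : IsSection E Y) (q : N) :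
    dirDeriv (Y.1 q) = 0 := ((mem_E_iff _ _).1 (hY q)).1

theorem IsSection.pointDeriv_eq_smul {Y : SmoothVectorField N} (hY : IsSection E Y) (q : N) :
    pointDeriv q (Y.1 q) = Y.1 q 0 • dirVec q := ((mem_E_iff _ _).1 (hY q)).2

theorem IsSection.pointDeriv_eq_zero {Y : SmoothVectorField N} (hY : IsSection V Y) (q : N) :
    pointDeriv q (Y.1 q) = 0 := (mem_V_iff _ _).1 (hY q)

theorem fderiv_smul_dirVec (X : SmoothVectorField N) (q v : N) :
    fderiv ℝ (fun p => X.1 p 0 • dirVec p) q v =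
      X.1 q 0 • dirDeriv v + fderiv ℝ (fun p => X.1 p 0) q v • dirVec q := by
  have h : DifferentiableAt ℝ (fun p => X.1 p 0) q :=
    differentiableAt_pi.1 (SmoothVectorField.differentiableAt X q) 0
  refine (DFunLike.congr_fun (h.hasFDerivAt.smul (hasFDerivAt_dirVec q)).fderiv v).trans ?_
  simp

theorem isGeneralizedPathGeometry : IsGeneralizedPathGeometry 3 E V where
  finiteDimensional := inferInstance
  finrank_eq := by simp
  line_bundle q := by
    refine ⟨Set.univ, isOpen_univ, Set.mem_univ q, fun _ => N₁, fun _ => ?_, fun p _ => ⟨?_, ?_⟩⟩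
    · apply ContDiff.contDiffOn
      rw [contDiff_pi]
      intro i
      fin_cases i <;> simp [N₁] <;> fun_prop
    · rw [linearIndependent_unique_iff]
      intro h
      simpa [N₁] using congrFun h 0
    · rw [Set.range_const, E]
  bundle q := by
    refine ⟨Set.univ, isOpen_univ, Set.mem_univ q, ![N₂, N₃, N₄], fun i => ?_, fun p _ => ⟨?_, ?_⟩⟩
    · fin_cases i <;> exact contDiffOn_const
    · rw [Fintype.linearIndependent_iff]
      intro g hg
      have h1 := congrFun hg 1
      have h2 := congrFun hg 2
      have h3 := congrFun hg 3
      simp [Fin.sum_univ_succ, N₂, N₃, N₄] at h1 h2 h3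
      intro i
      fin_cases i <;> assumption
    · rw [V]
      congr 1
      ext v
      simp; tauto
  inf_eq_bot q := by
    rw [eq_bot_iff]
    rintro v ⟨hE, hV⟩
    rw [SetLike.mem_coe, mem_E_iff] at hE
    rw [SetLike.mem_coe, mem_V_iff] at hV
    exact (Submodule.mem_bot ℝ).2 (deriv_injective (q := q) (by simp [hV]) (by simp [hE.1]))
  lie_mem X Y hX hY q := by
    -- `V` is the kernel of the differential of `pointVec`, so it is even involutive.
    refine Submodule.mem_sup_right ((mem_V_iff _ _).2 ?_)
    rw [pointDeriv_lie, funext hX.pointDeriv_eq_zero, funext hY.pointDeriv_eq_zero]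
    simp
  nondegenerate X Y hX hY q h := by
    have h := pointDeriv_of_mem_sup h
    rw [pointDeriv_lie, funext hX.pointDeriv_eq_smul, funext hY.pointDeriv_eq_zero,
      fderiv_smul_dirVec] at h
    by_cases h0 : X.1 q 0 = 0
    · left
      exact deriv_injective (q := q) (by rw [hX.pointDeriv_eq_smul, h0]; simp)
        (by rw [hX.dirDeriv_eq_zero]; simp)
    · right
      -- In coordinate 1 `dirDeriv` vanishes and `dirVec` is 1, so the multiples of `dirVec` on both
      -- sides agree and `X 0 • dirDeriv Y = 0` remains.
      have h1 := congrFun h 1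
      simp [dirDeriv_apply, dirVec] at h1
      rw [← h1] at h
      simp [h0] at h
      exact deriv_injective (q := q) (by rw [hY.pointDeriv_eq_zero]; simp) (by rw [h]; simp)

/-! ### Projective vector fields are symmetries -/

/-- The infinitesimal generator of `z ↦ exp (-t A) z` in the coordinates of `N`. -/
noncomputable def projField (A : Matrix (Fin 5) (Fin 5) ℝ) : SmoothVectorField N :=
  ⟨fun q => solve q ((-A).mulVec (pointVec q)) ((-A).mulVec (dirVec q)), by
    have h1 := contDiff_pi.1 contDiff_pointVec
    have h3 (i : Fin 5) : ContDiff ℝ ∞ fun q => (-A).mulVec (pointVec q) i :=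
      contDiff_pi.1 ((-A).mulVecLin.toContinuousLinearMap.contDiff.comp contDiff_pointVec) i
    have h4 (i : Fin 5) : ContDiff ℝ ∞ fun q => (-A).mulVec (dirVec q) i :=
      contDiff_pi.1 ((-A).mulVecLin.toContinuousLinearMap.contDiff.comp contDiff_dirVec) i
    change ContDiff ℝ ∞ _
    rw [contDiff_pi]
    intro i
    fin_cases i <;> simp only [solve] <;> dsimp <;> fun_prop⟩

theorem pointDeriv_projField (A : Matrix (Fin 5) (Fin 5) ℝ) (q : N) :
    pointDeriv q ((projField A).1 q) =
      A.mulVec (pointVec q) 0 • pointVec q - A.mulVec (pointVec q) := by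
  refine (pointDeriv_solve _ _ _).trans ?_
  simp only [Matrix.neg_mulVec, Pi.neg_apply, neg_smul]
  abel

theorem dirDeriv_projField (A : Matrix (Fin 5) (Fin 5) ℝ) (q : N) :
    dirDeriv ((projField A).1 q) =
      A.mulVec (dirVec q) 0 • pointVec q +
        (A.mulVec (dirVec q) 1 - A.mulVec (dirVec q) 0 * pointVec q 1) • dirVec q -
          A.mulVec (dirVec q) := by
  refine (dirDeriv_solve _ _ _).trans ?_
  simp only [Matrix.neg_mulVec, Pi.neg_apply, neg_smul, pointVec, Matrix.cons_val_one,
    Matrix.cons_val_zero]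
  module

theorem hasFDerivAt_mulVec_pointVec (A : Matrix (Fin 5) (Fin 5) ℝ) (q : N) :
    HasFDerivAt (fun p => A.mulVec (pointVec p))
      (A.mulVecLin.toContinuousLinearMap.comp (pointDeriv q)) q :=
  A.mulVecLin.toContinuousLinearMap.hasFDerivAt.comp q (hasFDerivAt_pointVec q)

theorem hasFDerivAt_mulVec_dirVec (A : Matrix (Fin 5) (Fin 5) ℝ) (q : N) :
    HasFDerivAt (fun p => A.mulVec (dirVec p))
      (A.mulVecLin.toContinuousLinearMap.comp dirDeriv) q :=
  A.mulVecLin.toContinuousLinearMap.hasFDerivAt.comp q (hasFDerivAt_dirVec q)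

theorem fderiv_pointDeriv_projField (A : Matrix (Fin 5) (Fin 5) ℝ) (q v : N) :
    fderiv ℝ (fun p => pointDeriv p ((projField A).1 p)) q v =
      A.mulVec (pointVec q) 0 • pointDeriv q v + A.mulVec (pointDeriv q v) 0 • pointVec q -
        A.mulVec (pointDeriv q v) := by
  rw [funext (pointDeriv_projField A)]
  have h := hasFDerivAt_mulVec_pointVec A q
  refine (DFunLike.congr_fun
    (((hasFDerivAt_pi'.1 h 0).smul (hasFDerivAt_pointVec q)).sub h).fderiv v).trans ?_
  simp

theorem fderiv_dirDeriv_projField (A : Matrix (Fin 5) (Fin 5) ℝ) (q v : N) :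
    fderiv ℝ (fun p => dirDeriv ((projField A).1 p)) q v =
      A.mulVec (dirVec q) 0 • pointDeriv q v + A.mulVec (dirDeriv v) 0 • pointVec q +
      ((A.mulVec (dirVec q) 1 - A.mulVec (dirVec q) 0 * pointVec q 1) • dirDeriv v +
        (A.mulVec (dirDeriv v) 1 - (A.mulVec (dirVec q) 0 * pointDeriv q v 1 +
          pointVec q 1 * A.mulVec (dirDeriv v) 0)) • dirVec q) -
        A.mulVec (dirDeriv v) := by
  rw [funext (dirDeriv_projField A)]
  have h := hasFDerivAt_mulVec_dirVec A q
  have h0 := hasFDerivAt_pi'.1 h 0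
  have h1 := hasFDerivAt_pi'.1 h 1
  have k := hasFDerivAt_pointVec q
  have k1 := hasFDerivAt_pi'.1 k 1
  refine (DFunLike.congr_fun (((h0.smul k).add
    ((h1.sub (h0.mul k1)).smul (hasFDerivAt_dirVec q))).sub h).fderiv v).trans ?_
  simp

theorem projField_mem (A : Matrix (Fin 5) (Fin 5) ℝ) : projField A ∈ symmetryAlgebra E V := by
  constructor
  · intro Y hY q
    have hd : dirDeriv ((⁅projField A, Y⁆ : SmoothVectorField N).1 q) = 0 := by
      rw [dirDeriv_lie, funext hY.dirDeriv_eq_zero, fderiv_dirDeriv_projField,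
        hY.dirDeriv_eq_zero, hY.pointDeriv_eq_smul]
      simp only [Matrix.mulVec_zero, Pi.zero_apply, Pi.smul_apply, smul_eq_mul,
        fderiv_fun_const, zero_apply, show dirVec q 1 = 1 from rfl]
      module
    have hp : pointDeriv q ((⁅projField A, Y⁆ : SmoothVectorField N).1 q) ∈
        Submodule.span ℝ {dirVec q} := by
      rw [pointDeriv_lie, funext hY.pointDeriv_eq_smul, fderiv_smul_dirVec,
        fderiv_pointDeriv_projField, dirDeriv_projField, hY.pointDeriv_eq_smul,
        Matrix.mulVec_smul, Submodule.mem_span_singleton]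
      -- The terms in `pointVec q` and in `A.mulVec (dirVec q)` cancel; this is the remaining
      -- coefficient of `dirVec q`.
      refine ⟨fderiv ℝ (fun p => Y.1 p 0) q ((projField A).1 q) + Y.1 q 0 *
        (A.mulVec (dirVec q) 1 - A.mulVec (dirVec q) 0 * pointVec q 1 -
          A.mulVec (pointVec q) 0), ?_⟩
      rw [Pi.smul_apply, smul_eq_mul]
      module
    obtain ⟨c, hc⟩ := Submodule.mem_span_singleton.1 hp
    refine (mem_E_iff _ _).2 ⟨hd, ?_⟩
    have : c = (⁅projField A, Y⁆ : SmoothVectorField N).1 q 0 := by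
      simpa [dirVec, pointDeriv_apply] using congrFun hc 1
    rw [← this, hc]
  · intro Y hY q
    rw [mem_V_iff, pointDeriv_lie, funext hY.pointDeriv_eq_zero, fderiv_pointDeriv_projField,
      hY.pointDeriv_eq_zero]
    simp

/-! ### Determination of a symmetry by its projection -/

/-- `N₁` as a smooth vector field. -/
noncomputable def fieldN₁ : SmoothVectorField N :=
  ⟨N₁, by
    change ContDiff ℝ ∞ _
    rw [contDiff_pi]
    intro i
    fin_cases i <;> simp [N₁] <;> fun_prop⟩

/-- Apply `pointDeriv` to `[X, N₁]`, a section of `E`. The point component of a symmetry thus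
determines its direction component modulo `dirVec`. -/
theorem fderiv_pointDeriv_N₁ {X : SmoothVectorField N} (hX : X ∈ symmetryAlgebra E V) (q : N) :
    ∃ c : ℝ, fderiv ℝ (fun p => pointDeriv p (X.1 p)) q (N₁ q) =
      dirDeriv (X.1 q) + c • dirVec q := by
  have h := (mem_E_iff _ _).1 (hX.1 fieldN₁ N₁_mem_E q)
  refine ⟨-(⁅X, fieldN₁⁆ : SmoothVectorField N).1 q 0, ?_⟩
  rw [neg_smul, ← h.2, pointDeriv_lie]
  simp only [fieldN₁, pointDeriv_N₁]
  rw [(hasFDerivAt_dirVec q).fderiv]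
  abel

theorem fderiv_dirDeriv_N₁ {X : SmoothVectorField N} (hX : X ∈ symmetryAlgebra E V) (q : N) :
    fderiv ℝ (fun p => dirDeriv (X.1 p)) q (N₁ q) = 0 := by
  have h := ((mem_E_iff _ _).1 (hX.1 fieldN₁ N₁_mem_E q)).1
  rw [dirDeriv_lie] at h
  simpa [fieldN₁, dirDeriv_N₁] using h

theorem fderiv_pointDeriv_of_mem_V {X : SmoothVectorField N} (hX : X ∈ symmetryAlgebra E V)
    {q v : N} (hv : v 0 = 0 ∧ v 4 = 0 ∧ v 5 = 0 ∧ v 6 = 0) :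
    fderiv ℝ (fun p => pointDeriv p (X.1 p)) q v = 0 := by
  have hV (p : N) : pointDeriv p v = 0 := by
    rw [pointDeriv_apply]; ext i; fin_cases i <;> simp [hv]
  have h := (mem_V_iff _ _).1 (hX.2 ⟨fun _ => v, (contDiff_const : ContDiff ℝ ∞ _)⟩
    (fun p => (mem_V_iff p v).2 (hV p)) q)
  rw [pointDeriv_lie] at h
  simpa [hV] using h

/-- Differentiating the point component along `N₁` recovers `dirDeriv` up to a multiple of `dirVec`,
and the vanishing of coordinate 1 of `dirDeriv` fixes that multiple. Identities between symmetries
need then only be checked on the point component. -/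
theorem eq_of_pointDeriv_eq {X X' : SmoothVectorField N} (hX : X ∈ symmetryAlgebra E V)
    (hX' : X' ∈ symmetryAlgebra E V) (h : ∀ q, pointDeriv q (X.1 q) = pointDeriv q (X'.1 q)) :
    X = X' := by
  ext1
  funext q
  refine deriv_injective (h q) ?_
  obtain ⟨c, hc⟩ := fderiv_pointDeriv_N₁ hX q
  obtain ⟨c', hc'⟩ := fderiv_pointDeriv_N₁ hX' q
  rw [funext h, hc'] at hc
  have : c' = c := by simpa [dirDeriv_apply, dirVec] using congrFun hc 1
  subst this
  exact (add_right_cancel hc).symm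

/-- The minus sign in the definition of `projField` makes this a homomorphism; generators of `exp (t
A)` would give an antihomomorphism. -/
theorem projField_lie (A B : Matrix (Fin 5) (Fin 5) ℝ) :
    projField ⁅A, B⁆ = ⁅projField A, projField B⁆ := by
  refine eq_of_pointDeriv_eq (projField_mem _)
    ((symmetryAlgebra E V).lie_mem (projField_mem A) (projField_mem B)) fun q => ?_
  rw [pointDeriv_lie, fderiv_pointDeriv_projField, fderiv_pointDeriv_projField,
    pointDeriv_projField, pointDeriv_projField, pointDeriv_projField, Ring.lie_def]
  simp only [Matrix.sub_mulVec, Matrix.mulVec_sub, Matrix.mulVec_smul, Matrix.mulVec_mulVec,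
    Pi.sub_apply, Pi.smul_apply, smul_eq_mul]
  module

theorem projField_add (A B : Matrix (Fin 5) (Fin 5) ℝ) :
    projField (A + B) = projField A + projField B := by
  refine eq_of_pointDeriv_eq (projField_mem _)
    (add_mem (projField_mem A) (projField_mem B)) fun q => ?_
  refine Eq.trans ?_ (map_add (pointDeriv q) _ _).symm
  rw [pointDeriv_projField, pointDeriv_projField, pointDeriv_projField, Matrix.add_mulVec,
    Pi.add_apply]
  module

theorem projField_smul (c : ℝ) (A : Matrix (Fin 5) (Fin 5) ℝ) :
    projField (c • A) = c • projField A := by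
  refine eq_of_pointDeriv_eq (projField_mem _)
    ((symmetryAlgebra E V).smul_mem c (projField_mem A)) fun q => ?_
  refine Eq.trans ?_ (map_smul (pointDeriv q) _ _).symm
  rw [pointDeriv_projField, pointDeriv_projField, Matrix.smul_mulVec, Pi.smul_apply, smul_eq_mul]
  module

theorem projField_one : projField 1 = 0 := by
  refine eq_of_pointDeriv_eq (projField_mem _) (zero_mem _) fun q => ?_
  rw [pointDeriv_projField]
  simp [pointVec]

theorem isRelatedToGenerator_projField (A : Matrix (Fin 5) (Fin 5) ℝ) :
    IsRelatedToGenerator (fun q => toModel (flagLift q)) (projField A).1 (-A) := by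
  intro q
  refine ⟨Set.univ, flagLift, Set.mem_univ q, isSmoothLift_flagLift, fun p _ => ?_⟩
  have h := (stabilizesFlag_sub_maurerCartan_iff p ((projField A).1 p)
    (-A * (flagLift p).1)).2 (by
      rw [← Matrix.mulVec_mulVec, ← Matrix.mulVec_mulVec, flagLift_mulVec_single_zero,
        flagLift_mulVec_single_one]; rfl)
  rw [Matrix.mul_assoc, ← neg_sub]
  rw [stabilizesFlag_iff] at h ⊢
  rw [Matrix.neg_mulVec, Matrix.neg_mulVec, neg_mem_iff, neg_mem_iff]
  exact h

/-! ### Projective vector fields on four-dimensional space -/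

/-- Along `τ v + e` with `v 0 = 0`, the hypothesis is an identity of polynomials in `τ`. Its
coefficients yield `B w w = λ(w) w` with `λ` linear for all `w`, and polarization finishes. -/
theorem exists_smul_of_diagonal {B : (Fin 4 → ℝ) →L[ℝ] (Fin 4 → ℝ) →L[ℝ] (Fin 4 → ℝ)}
    (hsymm : ∀ u w, B u w = B w u) (hB : ∀ v, v 0 = 1 → B v v = B v v 0 • v) (u w : Fin 4 → ℝ) :
    (2 : ℝ) • B u w =
      (2 * B (Pi.single 0 1) u 0 - B (Pi.single 0 1) (Pi.single 0 1) 0 * u 0) • w +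
      (2 * B (Pi.single 0 1) w 0 - B (Pi.single 0 1) (Pi.single 0 1) 0 * w 0) • u := by
  set e : Fin 4 → ℝ := Pi.single 0 1 with he
  have he0 : e 0 = 1 := by simp [he]
  have hline (v : Fin 4 → ℝ) (hv : v 0 = 0) (τ : ℝ) (i : Fin 4) :
      τ ^ 2 * B v v i + 2 * τ * B e v i + B e e i =
        (τ ^ 2 * B v v 0 + 2 * τ * B e v 0 + B e e 0) * (τ * v i + e i) := by
    have := congrFun (hB (τ • v + e) (by simp [hv, he0])) i
    simp only [map_add, map_smul, add_apply, smul_apply, Pi.add_apply, Pi.smul_apply, smul_eq_mul,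
      hsymm v e] at this
    linear_combination this
  have hpure (v : Fin 4 → ℝ) (hv : v 0 = 0) : B v v = (2 * B e v 0) • v ∧
      (2 : ℝ) • B e v = B e e 0 • v + (2 * B e v 0) • e := by
    have h0 : B v v 0 = 0 := by
      by_cases hv' : v = 0
      · simp [hv']
      · obtain ⟨i, hi⟩ := Function.ne_iff.1 hv'
        have h1 := hline v hv 1 i
        have h2 := hline v hv (-1) i
        have h3 := hline v hv 2 i
        have h4 := hline v hv 0 i
        have : B v v 0 * v i = 0 := by
          linear_combination (-h3 + 3 * h1 + h2 - 3 * h4) / 6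
        exact (mul_eq_zero.1 this).resolve_right hi
    constructor
    · ext i
      have h1 := hline v hv 1 i
      have h2 := hline v hv (-1) i
      have h4 := hline v hv 0 i
      rw [h0] at h1 h2 h4
      simp only [Pi.smul_apply, smul_eq_mul]
      linear_combination (h1 + h2) / 2 - h4
    · ext i
      have h1 := hline v hv 1 i
      have h2 := hline v hv (-1) i
      rw [h0] at h1 h2
      simp only [Pi.smul_apply, Pi.add_apply, smul_eq_mul]
      linear_combination (h1 - h2) / 2
  have hee : B e e = B e e 0 • e := hB e he0
  have hdiag (w : Fin 4 → ℝ) : B w w = (2 * B e w 0 - B e e 0 * w 0) • w := by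
    obtain ⟨v, s, hv, rfl⟩ : ∃ v s, v 0 = 0 ∧ w = v + s • e :=
      ⟨w - w 0 • e, w 0, by simp [he0], by simp⟩
    obtain ⟨h1, h2⟩ := hpure v hv
    have h : B (v + s • e) (v + s • e) = B v v + s • (2 : ℝ) • B e v + s ^ 2 • B e e := by
      simp only [map_add, map_smul, add_apply, smul_apply, hsymm v e]
      module
    rw [h, h1, h2, hee]
    simp only [map_add, map_smul, Pi.add_apply, Pi.smul_apply, smul_eq_mul, hv, he0]
    module
  have h := hdiag (u + w)
  have h1 := hdiag u
  have h2 := hdiag w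
  simp only [map_add, add_apply, hsymm w u, h1, h2, Pi.add_apply] at h
  ext i
  have h := congrFun h i
  simp only [Pi.add_apply, Pi.smul_apply, smul_eq_mul] at h ⊢
  linear_combination h

/-- Testing on `eᵢ, eⱼ, eⱼ` with `i ≠ j` gives `T eⱼ eⱼ = 0` and `2 T eᵢ eⱼ = T eⱼ eᵢ`; exchanging
`i` and `j` kills the off-diagonal entries. -/
theorem eq_zero_of_symmetrized {T : (Fin 4 → ℝ) →L[ℝ] (Fin 4 → ℝ) →L[ℝ] ℝ}
    (hT : ∀ h u w, T h u • w + T h w • u = T u h • w + T u w • h) : T = 0 := by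
  have key (i j : Fin 4) (hij : i ≠ j) :
      T (Pi.single j 1) (Pi.single j 1) = 0 ∧
        2 * T (Pi.single i 1) (Pi.single j 1) = T (Pi.single j 1) (Pi.single i 1) := by
    have := hT (Pi.single i 1) (Pi.single j 1) (Pi.single j 1)
    have hi := congrFun this i
    have hj := congrFun this j
    simp [hij, hij.symm] at hi hj
    exact ⟨hi.symm, by linarith⟩
  have h (i j : Fin 4) : T (Pi.single i 1) (Pi.single j 1) = 0 := by
    by_cases hij : i = j
    · subst hij
      obtain ⟨k, hk⟩ := exists_ne i
      exact (key k i hk).1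
    · linarith [(key i j hij).2, (key j i (Ne.symm hij)).2]
  apply ContinuousLinearMap.coe_injective
  refine (Pi.basisFun ℝ (Fin 4)).ext fun i => ?_
  apply ContinuousLinearMap.coe_injective
  refine (Pi.basisFun ℝ (Fin 4)).ext fun j => ?_
  simpa using h i j

/-- A smooth vector field on `ℝ⁴` whose second derivative along every line with direction `v`,
`v 0 = 1`, is tangent to that line, is an infinitesimal projective transformation. -/
theorem exists_quadratic {F : (Fin 4 → ℝ) → (Fin 4 → ℝ)} (hF : ContDiff ℝ ∞ F)
    (h : ∀ z v : Fin 4 → ℝ, v 0 = 1 → ∀ i, ∃ b, ∀ t : ℝ,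
      HasDerivAt (fun t : ℝ => F (z + t • v) i - v i * F (z + t • v) 0) b t) :
    ∃ (L : (Fin 4 → ℝ) →ₗ[ℝ] (Fin 4 → ℝ)) (φ : (Fin 4 → ℝ) →ₗ[ℝ] ℝ),
      ∀ z, F z = F 0 + L z + φ z • z := by
  have hG : ContDiff ℝ ∞ (fderiv ℝ F) := hF.fderiv_right (by simp)
  have hB : ContDiff ℝ ∞ (fderiv ℝ (fderiv ℝ F)) := hG.fderiv_right (by simp)
  have dF (z) : HasFDerivAt F (fderiv ℝ F z) z := (hF.differentiable (by simp) z).hasFDerivAt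
  have dG (z) : HasFDerivAt (fderiv ℝ F) (fderiv ℝ (fderiv ℝ F) z) z :=
    (hG.differentiable (by simp) z).hasFDerivAt
  have dB (z) : HasFDerivAt (fderiv ℝ (fderiv ℝ F)) (fderiv ℝ (fderiv ℝ (fderiv ℝ F)) z) z :=
    (hB.differentiable (by simp) z).hasFDerivAt
  set G := fderiv ℝ F
  set B := fderiv ℝ G
  have dline (z v : Fin 4 → ℝ) (t : ℝ) : HasDerivAt (fun t : ℝ => z + t • v) v t := by
    simpa using ((hasDerivAt_id t).smul_const v).const_add z
  -- The hypothesis says that `F i - v i * F 0` is affine along the line, so its second derivative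
  -- vanishes.
  have hdiag (z v : Fin 4 → ℝ) (hv : v 0 = 1) : B z v v = B z v v 0 • v := by
    ext i
    obtain ⟨b, hb⟩ := h z v hv i
    have h1 (t : ℝ) : HasDerivAt (fun t : ℝ => F (z + t • v)) (G (z + t • v) v) t :=
      (dF _).comp_hasDerivAt t (dline z v t)
    have h2 (t : ℝ) : G (z + t • v) v i - v i * G (z + t • v) v 0 = b :=
      (((hasDerivAt_pi.1 (h1 t) i).sub ((hasDerivAt_pi.1 (h1 t) 0).const_mul (v i))).unique (hb t))
    have h3 (t : ℝ) : HasDerivAt (fun t : ℝ => G (z + t • v) v) (B (z + t • v) v v) t := by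
      simpa using ((dG _).comp_hasDerivAt t (dline z v t)).clm_apply (hasDerivAt_const t v)
    have h4 := ((hasDerivAt_pi.1 (h3 0) i).sub ((hasDerivAt_pi.1 (h3 0) 0).const_mul (v i)))
    have h5 := h4.unique ((hasDerivAt_const (0 : ℝ) b).congr_of_eventuallyEq
      (Filter.Eventually.of_forall fun t => h2 t))
    simp only [zero_smul, add_zero] at h5
    simp only [Pi.smul_apply, smul_eq_mul]
    linarith
  have hsymm (z u w : Fin 4 → ℝ) : B z u w = B z w u :=
    second_derivative_symmetric dF (dG z) u w
  have hsymm' (z u w : Fin 4 → ℝ) : fderiv ℝ B z u w = fderiv ℝ B z w u :=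
    second_derivative_symmetric dG (dB z) u w
  let e : Fin 4 → ℝ := Pi.single 0 1
  let p : (Fin 4 → ℝ) →L[ℝ] ℝ := ContinuousLinearMap.proj 0
  let Λ : (Fin 4 → ℝ) → (Fin 4 → ℝ) →L[ℝ] ℝ := fun z =>
    (2 : ℝ) • p.comp (B z e) - p (B z e e) • p
  have hΛ : ContDiff ℝ ∞ Λ := by fun_prop
  have dΛ (z) : HasFDerivAt Λ (fderiv ℝ Λ z) z := (hΛ.differentiable (by simp) z).hasFDerivAt
  have hBΛ (z u w : Fin 4 → ℝ) : (2 : ℝ) • B z u w = Λ z u • w + Λ z w • u :=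
    exists_smul_of_diagonal (hsymm z) (hdiag z) u w
  -- Differentiating `hBΛ` expresses the third derivative of `F` through that of `Λ`; the symmetry
  -- of the former in its first two arguments forces `Λ` to be constant.
  have hΛ0 (z) : fderiv ℝ Λ z = 0 := by
    apply eq_zero_of_symmetrized
    have h1 (k u w : Fin 4 → ℝ) : (2 : ℝ) • fderiv ℝ B z k u w =
        fderiv ℝ Λ z k u • w + fderiv ℝ Λ z k w • u := by
      have d1 := (((dB z).clm_apply (hasFDerivAt_const u z)).clm_apply
        (hasFDerivAt_const w z)).const_smul (2 : ℝ)
      have d2 := (((dΛ z).clm_apply (hasFDerivAt_const u z)).smul_const w).add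
        (((dΛ z).clm_apply (hasFDerivAt_const w z)).smul_const u)
      have := d1.unique (d2.congr_of_eventuallyEq (Filter.Eventually.of_forall fun t => hBΛ t u w))
      simpa using DFunLike.congr_fun this k
    intro k u w
    rw [← h1, hsymm', h1]
  have hΛc (z) : Λ z = Λ 0 := is_const_of_fderiv_eq_zero (hΛ.differentiable (by simp)) hΛ0 z 0
  let φ : (Fin 4 → ℝ) →L[ℝ] ℝ := (1 / 2 : ℝ) • Λ 0
  have hBφ (z u w : Fin 4 → ℝ) : B z u w = φ u • w + φ w • u := by
    have := hBΛ z u w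
    rw [hΛc] at this
    have h2 : B z u w = (1 / 2 : ℝ) • (2 : ℝ) • B z u w := by module
    rw [h2, this]
    simp only [φ, smul_apply, smul_eq_mul]
    module
  have hGφ (z u : Fin 4 → ℝ) : G z u = G 0 u + φ z • u + φ u • z := by
    have d (z : Fin 4 → ℝ) : HasFDerivAt (fun z => G z u - φ z • u - φ u • z)
        (0 : (Fin 4 → ℝ) →L[ℝ] (Fin 4 → ℝ)) z := by
      refine (((((dG z).clm_apply (hasFDerivAt_const u z)).sub (φ.hasFDerivAt.smul_const u))).sub
        ((hasFDerivAt_id z).const_smul (φ u))).congr_fderiv ?_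
      ext1 k
      simp [hBφ]
    have := is_const_of_fderiv_eq_zero (fun z => (d z).differentiableAt) (fun z => (d z).fderiv) z 0
    simp only [map_zero, zero_smul, smul_zero, sub_zero] at this
    rw [← this]
    abel
  refine ⟨G 0, φ, fun z => ?_⟩
  have d (z : Fin 4 → ℝ) : HasFDerivAt (fun z => F z - G 0 z - φ z • z)
      (0 : (Fin 4 → ℝ) →L[ℝ] (Fin 4 → ℝ)) z := by
    refine (((dF z).sub (G 0).hasFDerivAt).sub
      (φ.hasFDerivAt.smul (hasFDerivAt_id z))).congr_fderiv ?_
    ext1 k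
    simp [hGφ z k]
    abel
  have := is_const_of_fderiv_eq_zero (fun z => (d z).differentiableAt) (fun z => (d z).fderiv) z 0
  simp only [map_zero, smul_zero, sub_zero] at this
  rw [← this, ContinuousLinearMap.coe_coe, ContinuousLinearMap.coe_coe]
  abel

/-! ### Descent of symmetries to four-dimensional space -/

/-- The inverse of the coordinate system consisting of the coordinates of `pointVec` and `ℓ`. -/
noncomputable def chart (z : Fin 4 → ℝ) (l : Fin 3 → ℝ) : N :=
  ![z 0, l 0, l 1, l 2, z 1 + (√3 / 4 * z 0 ^ 2 + z 0), z 2 + z 0,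
    z 3 - (√3 / 4 * z 0 ^ 2 - z 0)]

theorem pointVec_chart (z : Fin 4 → ℝ) (l : Fin 3 → ℝ) :
    pointVec (chart z l) = Matrix.vecCons 1 z := by
  ext i; fin_cases i <;> simp [pointVec, chart] <;> ring

theorem exists_chart_eq (q : N) : ∃ z l, q = chart z l := by
  refine ⟨Matrix.vecTail (pointVec q), ![q 1, q 2, q 3], ?_⟩
  ext i; fin_cases i <;> simp [pointVec, chart] <;> ring

theorem contDiff_chart_zero : ContDiff ℝ ∞ fun z => chart z 0 := by
  rw [contDiff_pi]
  intro i
  fin_cases i <;> simp [chart] <;> fun_prop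

theorem chart_eq_add (z : Fin 4 → ℝ) (l : Fin 3 → ℝ) (s : ℝ) :
    chart z (s • l) = chart z 0 + s • ![0, l 0, l 1, l 2, 0, 0, 0] := by
  ext i; fin_cases i <;> simp [chart]

theorem hasDerivAt_chart_line (z v : Fin 4 → ℝ) (hv : v 0 = 1) (t : ℝ) :
    HasDerivAt (fun t : ℝ => chart (z + t • v) ![-v 1, -v 2, -v 3])
      (N₁ (chart (z + t • v) ![-v 1, -v 2, -v 3])) t := by
  have h (i : Fin 4) : HasDerivAt (fun t : ℝ => z i + t * v i) (v i) t := by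
    simpa using ((hasDerivAt_id t).mul_const (v i)).const_add (z i)
  rw [hasDerivAt_pi]
  intro i
  fin_cases i
  · exact (h 0).congr_deriv (by simp [N₁, hv])
  · exact (hasDerivAt_const t (-v 1)).congr_deriv (by simp [N₁])
  · exact (hasDerivAt_const t (-v 2)).congr_deriv (by simp [N₁])
  · exact (hasDerivAt_const t (-v 3)).congr_deriv (by simp [N₁])
  · refine ((h 1).add ((((h 0).pow 2).const_mul (√3 / 4)).add (h 0))).congr_deriv ?_
    simp [N₁, hv, chart]; ring
  · refine ((h 2).add (h 0)).congr_deriv ?_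
    simp [N₁, hv, chart]; ring
  · refine ((h 3).sub ((((h 0).pow 2).const_mul (√3 / 4)).sub (h 0))).congr_deriv ?_
    simp [N₁, hv, chart]; ring

theorem contDiff_pointDeriv (X : SmoothVectorField N) :
    ContDiff ℝ ∞ fun p => pointDeriv p (X.1 p) := by
  simp only [pointDeriv_eq_fderiv]
  exact (contDiff_pointVec.fderiv_right (m := ∞) (by simp)).clm_apply X.2

theorem contDiff_dirDeriv (X : SmoothVectorField N) : ContDiff ℝ ∞ fun p => dirDeriv (X.1 p) :=
  dirDeriv.contDiff.comp X.2

/-- The point component is constant along segments in the fibres of `V`, so the symmetry descends.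
-/
theorem pointDeriv_chart {X : SmoothVectorField N} (hX : X ∈ symmetryAlgebra E V)
    (z : Fin 4 → ℝ) (l : Fin 3 → ℝ) :
    pointDeriv (chart z l) (X.1 (chart z l)) = pointDeriv (chart z 0) (X.1 (chart z 0)) := by
  have d (s : ℝ) : HasDerivAt (fun s : ℝ => pointDeriv (chart z (s • l)) (X.1 (chart z (s • l))))
      0 s := by
    have h1 : HasDerivAt (fun s : ℝ => chart z (s • l)) ![0, l 0, l 1, l 2, 0, 0, 0] s := by
      simp only [chart_eq_add z l]
      simpa using ((hasDerivAt_id s).smul_const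
        (![0, l 0, l 1, l 2, 0, 0, 0] : Fin 7 → ℝ)).const_add (chart z 0)
    refine ((((contDiff_pointDeriv X).differentiable (by simp) _).hasFDerivAt).comp_hasDerivAt s
      h1).congr_deriv ?_
    exact fderiv_pointDeriv_of_mem_V hX (by simp)
  have := is_const_of_deriv_eq_zero (fun s => (d s).differentiableAt) (fun s => (d s).deriv) 1 0
  simpa using this

theorem exists_hasDerivAt {X : SmoothVectorField N} (hX : X ∈ symmetryAlgebra E V)
    (z v : Fin 4 → ℝ) (hv : v 0 = 1) (i : Fin 4) : ∃ b, ∀ t : ℝ,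
      HasDerivAt (fun t : ℝ =>
        pointDeriv (chart (z + t • v) 0) (X.1 (chart (z + t • v) 0)) i.succ -
          v i * pointDeriv (chart (z + t • v) 0) (X.1 (chart (z + t • v) 0)) 1) b t := by
  -- With this fibre coordinate the lift of the line `z + t v` is an integral curve of `N₁`.
  set l : Fin 3 → ℝ := ![-v 1, -v 2, -v 3] with hl
  have dγ := hasDerivAt_chart_line z v hv
  rw [← hl] at dγ
  have hdir (t : ℝ) : dirVec (chart (z + t • v) l) = Matrix.vecCons 0 v := by
    ext i; fin_cases i <;> simp [dirVec, chart, hl, hv]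
  have h1 (t : ℝ) := (((contDiff_pointDeriv X).differentiable (by simp) _).hasFDerivAt).comp_hasDerivAt
    t (dγ t)
  have h2 (t : ℝ) := (((contDiff_dirDeriv X).differentiable (by simp) _).hasFDerivAt).comp_hasDerivAt
    t (dγ t)
  simp only [fderiv_dirDeriv_N₁ hX] at h2
  have hc (t : ℝ) := is_const_of_deriv_eq_zero (fun s => (h2 s).differentiableAt)
    (fun s => (h2 s).deriv) t 0
  -- `dirDeriv X` is constant along the lift, so its value at `t = 0` serves for all `t`;
  -- subtracting `v i` times component 1 removes the unknown multiple of `dirVec = (0, v)`.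
  refine ⟨dirDeriv (X.1 (chart (z + (0 : ℝ) • v) l)) i.succ, fun t => ?_⟩
  simp only [← pointDeriv_chart hX _ l]
  refine ((hasDerivAt_pi.1 (h1 t) i.succ).sub
    ((hasDerivAt_pi.1 (h1 t) 1).const_mul (v i))).congr_deriv ?_
  obtain ⟨c, hc'⟩ := fderiv_pointDeriv_N₁ hX (chart (z + t • v) l)
  rw [hc', hdir]
  have hct := hc t
  simp only [Function.comp_apply] at hct
  rw [hct]
  simp [dirDeriv_apply, hv, mul_comm]

/-! ### Every symmetry comes from a trace-free matrix -/

theorem exists_projField_eq {X : SmoothVectorField N} (hX : X ∈ symmetryAlgebra E V) :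
    ∃ A : Matrix (Fin 5) (Fin 5) ℝ, projField A = X := by
  obtain ⟨L, φ, hF⟩ := exists_quadratic
    (F := fun z i => pointDeriv (chart z 0) (X.1 (chart z 0)) i.succ)
    (contDiff_pi.2 fun i => contDiff_pi.1 ((contDiff_pointDeriv X).comp contDiff_chart_zero) i.succ)
    (fun z v hv i => exists_hasDerivAt hX z v hv i)
  set c : Fin 4 → ℝ := fun i => pointDeriv (chart 0 0) (X.1 (chart 0 0)) i.succ
  -- In block form `A = (0, φ; -c, -L)`, read off by comparing `c + L z + φ(z) z` with `(A p)₀ p - A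
  -- p` at `p = (1, z)`.
  let A : Matrix (Fin 5) (Fin 5) ℝ := Matrix.of (Matrix.vecCons
    (Matrix.vecCons 0 fun j => φ (Pi.single j 1))
    fun i => Matrix.vecCons (-c i) fun j => -L (Pi.single j 1) i)
  have hz (z : Fin 4 → ℝ) : z = ∑ j, z j • Pi.single j 1 := by
    ext i; simp [Finset.sum_apply, Pi.single_apply]
  have hA0 (z : Fin 4 → ℝ) : A.mulVec (Matrix.vecCons 1 z) 0 = φ z := by
    conv_rhs => rw [hz z, map_sum]
    simp [A, Matrix.mulVec, dotProduct, Fin.sum_univ_succ, mul_comm]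
  have hA (z : Fin 4 → ℝ) (i : Fin 4) :
      A.mulVec (Matrix.vecCons 1 z) i.succ = -c i - L z i := by
    conv_rhs => rw [hz z, map_sum]
    simp [A, Matrix.mulVec, dotProduct, Fin.sum_univ_succ, mul_comm]
    ring
  refine ⟨A, eq_of_pointDeriv_eq (projField_mem A) hX fun q => ?_⟩
  obtain ⟨z, l, rfl⟩ := exists_chart_eq q
  rw [pointDeriv_projField, pointDeriv_chart hX, pointVec_chart, hA0]
  ext i
  refine Fin.cases ?_ (fun i => ?_) i
  · rw [Pi.sub_apply, hA0]
    simp [pointDeriv_apply]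
  · have := congrFun (hF z) i
    simp only [Pi.add_apply, Pi.smul_apply, smul_eq_mul] at this
    rw [Pi.sub_apply, hA, this]
    simp
    ring

/-- Every `(1, z)` is an eigenvector of `A`; the choices `z = 0` and `z = ±eⱼ` already force `A` to
be scalar. -/
theorem eq_smul_one_of_projField_eq_zero {A : Matrix (Fin 5) (Fin 5) ℝ} (hA : projField A = 0) :
    A = A 0 0 • 1 := by
  have h (z : Fin 4 → ℝ) (i : Fin 5) : A.mulVec (Matrix.vecCons 1 z) 0 * Matrix.vecCons 1 z i =
      A.mulVec (Matrix.vecCons 1 z) i := by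
    have := pointDeriv_projField A (chart z 0)
    rw [hA, pointVec_chart] at this
    have := congrFun ((map_zero (pointDeriv (chart z 0))).symm.trans this) i
    simp only [Pi.zero_apply, Pi.sub_apply, Pi.smul_apply, smul_eq_mul] at this
    linarith
  have hmul (j : Fin 4) (s : ℝ) (i : Fin 5) :
      A.mulVec (Matrix.vecCons 1 (s • Pi.single j 1)) i = A i 0 + s * A i j.succ := by
    simp [Matrix.mulVec, dotProduct, Fin.sum_univ_succ, Pi.single_apply, mul_comm,
      Matrix.vecCons, Fin.cons_zero, Fin.cons_succ]
  have hcol (i : Fin 4) : A i.succ 0 = 0 := by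
    have h0 := h ((0 : ℝ) • Pi.single 0 1) i.succ
    rw [hmul, hmul] at h0
    simpa using h0.symm
  have hdiag (j : Fin 4) : A 0 j.succ = 0 ∧ A j.succ j.succ = A 0 0 := by
    have h1 := h ((1 : ℝ) • Pi.single j 1) j.succ
    have h2 := h ((-1 : ℝ) • Pi.single j 1) j.succ
    rw [hmul, hmul, hcol] at h1 h2
    simp at h1 h2
    constructor <;> linarith
  have hoff (i j : Fin 4) (hij : i ≠ j) : A i.succ j.succ = 0 := by
    have h1 := h ((1 : ℝ) • Pi.single j 1) i.succ
    rw [hmul, hmul, hcol] at h1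
    simpa [hij] using h1.symm
  ext i j
  refine Fin.cases (Fin.cases ?_ (fun j => ?_) j) (fun i => Fin.cases ?_ (fun j => ?_) j) i
  · simp
  · simp [(hdiag j).1, (Fin.succ_ne_zero j).symm]
  · simp [hcol i]
  · by_cases hij : i = j
    · subst hij
      simp [(hdiag i).2]
    · simp [hoff i j hij, hij]

theorem sl_val_trace (A : LieAlgebra.SpecialLinear.sl (Fin 5) ℝ) : A.1.trace = 0 := A.2

/-- The Lie algebra homomorphism from `sl(5, ℝ)` to the infinitesimal symmetries. -/
noncomputable def slToSymmetry :
    LieAlgebra.SpecialLinear.sl (Fin 5) ℝ →ₗ⁅ℝ⁆ symmetryAlgebra E V where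
  toFun A := ⟨projField A.1, projField_mem A.1⟩
  map_add' A B := Subtype.ext (projField_add A.1 B.1)
  map_smul' c A := Subtype.ext (projField_smul c A.1)
  map_lie' {A B} := Subtype.ext (projField_lie A.1 B.1)

theorem slToSymmetry_bijective : Function.Bijective slToSymmetry := by
  constructor
  · rw [injective_iff_map_eq_zero]
    intro A hA
    have h := eq_smul_one_of_projField_eq_zero (congrArg Subtype.val hA)
    have ht := sl_val_trace A
    rw [h] at ht
    have h0 : A.1 0 0 = 0 := by simpa using ht
    rw [h0, zero_smul] at h
    exact Subtype.ext h
  · rintro ⟨X, hX⟩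
    obtain ⟨A, rfl⟩ := exists_projField_eq hX
    -- Scalars act trivially, so the trace can be removed without changing the field.
    have hA : (A + (-(A.trace / 5)) • (1 : Matrix (Fin 5) (Fin 5) ℝ)).trace = 0 := by
      rw [Matrix.trace_add, Matrix.trace_smul, Matrix.trace_one, Fintype.card_fin, smul_eq_mul]
      push_cast
      ring
    refine ⟨⟨_, hA⟩, Subtype.ext ?_⟩
    change projField _ = projField A
    rw [projField_add, projField_smul, projField_one, smul_zero, add_zero]

theorem finrank_sl_five : finrank ℝ (LieAlgebra.SpecialLinear.sl (Fin 5) ℝ) = 24 := by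
  have hr : LinearMap.range (Matrix.traceLinearMap (Fin 5) ℝ ℝ) = ⊤ := by
    rw [LinearMap.range_eq_top]
    exact fun c => ⟨Matrix.single 0 0 c, by simp⟩
  have h := LinearMap.finrank_range_add_finrank_ker (Matrix.traceLinearMap (Fin 5) ℝ ℝ)
  rw [hr, finrank_top, finrank_self, finrank_matrix] at h
  simp only [Fintype.card_fin, finrank_self] at h
  change finrank ℝ (LinearMap.ker (Matrix.traceLinearMap (Fin 5) ℝ ℝ)) = 24
  omega

end PathGeometry

theorem mainTheorem3 :
    PathGeometry.IsGeneralizedPathGeometry 3 PathGeometry.E PathGeometry.V ∧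
    Module.finrank ℝ (PathGeometry.symmetryAlgebra PathGeometry.E PathGeometry.V) = 24 ∧
    ∃ (Φ : LieAlgebra.SpecialLinear.sl (Fin 5) ℝ ≃ₗ⁅ℝ⁆
          PathGeometry.symmetryAlgebra PathGeometry.E PathGeometry.V)
      (f : PathGeometry.N → PathGeometry.FlatModel),
      Function.Injective f ∧
      PathGeometry.IsLocalIsoToModel PathGeometry.E PathGeometry.V f ∧
      ∀ A, PathGeometry.IsRelatedToGenerator f (Φ A).1.1 (-A.1) := by
  let Φ := LieEquiv.ofBijective PathGeometry.slToSymmetry PathGeometry.slToSymmetry_bijective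
  exact ⟨PathGeometry.isGeneralizedPathGeometry,
    Φ.toLinearEquiv.finrank_eq.symm.trans PathGeometry.finrank_sl_five,
    Φ, fun q => PathGeometry.toModel (PathGeometry.flagLift q),
    PathGeometry.injective_toModel_flagLift, PathGeometry.isLocalIsoToModel,
    fun A => PathGeometry.isRelatedToGenerator_projField A.1⟩
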